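/- Let $k$ be a prime power, $m=4k$, $V=\{1,\dots,m\}$, and let $W$ be the set of the $\binom m2$ two-element subsets of $V$. For a $2k$-subset $A$ of $V$ let $S(A)=\{\{a,b\}: a\in A,\ b\in V\setminus A\}\subseteq W$, regarded as a $0/1$-vector in the Euclidean space $\mathbb R^W$. Let $K=\{S(A): A\subseteq V,\ |A|=2k\}\subseteq\mathbb R^W$, and put $$d=\binom{m}{2}-1,\qquad q=\frac{\binom{4k}{2k}}{2\binom{4k-1}{k-1}}.$$ Then: 1. $K$ lies in a $d$-dimensional affine subspace of $\mathbb R^W$. 2. Every $T\subseteq K$ with $\operatorname{diam}(T)<\operatorname{diam}(K)$ has at most $\binom{4k-1}{k-1}$ points. 3. $|K|/\binom{4k-1}{k-1}=q$, and every family $P$ of subsets of $K$, each of diameter smaller than $\operatorname{diam}(K)$, whose union is $K$ satisfies $|P|\ge q$. 4. $q$ is twice the number $\frac12\binom{4k}{2k}\big/\big(2\binom{4k-1}{k-1}\big)$, the lower bound stated by Kahn and Kalai. 5. If $q>d+1$, then $K$ is a counterexample to Borsuk's conjecture in every dimension $n$ with $d\le n<q-1$: there is an isometric copy of $K$ in $\mathbb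 R^n$, and it is a bounded set with at least two points that is not the union of $n+1$ subsets of smaller diameter. -/

import Mathlib

namespace KahnKalai

/-- The two-element subsets `{a, b}` of an `m`-element set, as non-diagonal unordered pairs. -/
abbrev Pair (m : ℕ) : Type := {e : Sym2 (Fin m) // ¬ e.IsDiag}

/-- The set of all pairs `{a, b}` with `a ∈ A` and `b ∉ A`. -/
def cut {m : ℕ} (A : Finset (Fin m)) : Set (Pair m) :=
  {e | ∃ a ∈ A, ∃ b ∉ A, e.1 = s(a, b)}

/-- The 0/1-vector, with coordinates indexed by `ι`, of a subset of `ι`; it is a point of the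
Euclidean space `ℝ^ι`. -/
noncomputable def zeroOneVector {ι : Type} (X : Set ι) : EuclideanSpace ℝ ι :=
  WithLp.toLp 2 (X.indicator (fun _ => (1 : ℝ)))

/-- The point set `K`: the 0/1-vectors of the sets `cut A`, for `A` a `2k`-subset of a
`4k`-element set. -/
def pointSet (k : ℕ) : Set (EuclideanSpace ℝ (Pair (4 * k))) :=
  {x | ∃ A : Finset (Fin (4 * k)), A.card = 2 * k ∧ x = zeroOneVector (cut A)}

/-- The dimension `d = C(4k, 2) - 1`; the subtraction is a genuine one for `k ≥ 1`. -/
def dimension (k : ℕ) : ℕ := (4 * k).choose 2 - 1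

/-- The number `q = C(4k, 2k) / (2 C(4k-1, k-1))`. -/
noncomputable def coverBound (k : ℕ) : ℝ :=
  ((4 * k).choose (2 * k) : ℝ) / (2 * ((4 * k - 1).choose (k - 1) : ℝ))

/-- The earlier bound of Kahn and Kalai, in which the number of points of a subset of smaller
diameter is estimated by `2 C(4k-1, k-1)`. -/
noncomputable def kahnKalaiBound (k : ℕ) : ℝ :=
  (1 / 2 * ((4 * k).choose (2 * k) : ℝ)) / (2 * ((4 * k - 1).choose (k - 1) : ℝ))

/-- `X` is a counterexample to Borsuk's conjecture in dimension `n`: a bounded set with at least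
two points in `n`-dimensional Euclidean space which is not a union of `n + 1` subsets of smaller
diameter. The parts may overlap or be empty. -/
def IsBorsukCounterexample (n : ℕ) (X : Set (EuclideanSpace ℝ (Fin n))) : Prop :=
  Bornology.IsBounded X ∧ X.Nontrivial ∧
    ¬ ∃ T : Fin (n + 1) → Set (EuclideanSpace ℝ (Fin n)),
      (∀ i, T i ⊆ X ∧ Metric.diam (T i) < Metric.diam X) ∧ (⋃ i, T i) = X

end KahnKalai

/-!
The points of `K` are the cuts of the balanced bipartitions `{A, Aᶜ}` of a `4k`-element set. The
symmetric difference of the cuts of `A` and `B` is the cut of `A ∆ B` (`cut_symmDiff`), and the cut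
of a `c`-set has `c (4k - c)` elements (`ncard_cut`). Hence the squared distance of two points is
`c (4k - c) ≤ 4k²` with `c = #(A ∆ B)`, and the value `4k²` occurs exactly for `c = 2k`, that is,
for `#(A ∩ B) = k`. A part of smaller diameter is therefore a family of `2k`-sets no two of which
meet in exactly `k` elements.

Replacing sets by complements, all of them may be taken to contain a fixed element `v`; removing
`v` leaves a family of `(2k-1)`-subsets of a `(4k-1)`-element set, no two meeting in exactly `k - 1`
elements. The bound `C(4k-1, k-1)` for such a family is `card_le_choose_of_card_inter_ne`, a case of
the theorem of Frankl and Wilson: for `k` a power of the prime `p`, the number `C(t, k-1)` with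
`t ≤ 2k-1`, `t ≠ k-1` is `0` modulo `p` unless `t = 2k-1`, where it is `1`. As `C(#(A ∩ B), k-1)`
counts the `(k-1)`-sets contained in both `A` and `B`, the rows of the inclusion matrix between the
family and the `(k-1)`-subsets of the ground set are orthonormal over `ZMod p` for the dot product,
hence linearly independent.

All cuts have `4k²` elements, so `K` lies in a hyperplane of `ℝ^W`, whose dimension is
`C(4k, 2) - 1`; this hyperplane embeds isometrically in every `ℝⁿ` with `n` at least its dimension.
-/

namespace KahnKalai

open Finset Module

/-! ### A modular intersection theorem -/

/-- The coefficient of `X ^ (q - 1)` in `(1 + X) ^ (q + y) = (1 + X ^ q) (1 + X) ^ y` modulo `p`, for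
`q = p ^ n`; in the proof, only one term of Vandermonde's sum is nonzero modulo `p`. -/
theorem cast_choose_add_pow_pred {p n y : ℕ} (hp : p.Prime) (hy : y < p ^ n) :
    (((p ^ n + y).choose (p ^ n - 1) : ℕ) : ZMod p) = if y = p ^ n - 1 then 1 else 0 := by
  have hpos : 0 < p ^ n := pow_pos hp.pos n
  rw [Nat.add_choose_eq, Nat.cast_sum, Finset.sum_eq_single (0, p ^ n - 1)]
  · rcases eq_or_ne y (p ^ n - 1) with h | h
    · simp [← h]
    · rw [if_neg h, Nat.choose_eq_zero_of_lt (show y < p ^ n - 1 by omega)]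
      simp
  · rintro ⟨i, j⟩ hij hne
    have hij' : i + j = p ^ n - 1 := by simpa using hij
    have hi : i ≠ 0 := by
      rintro rfl
      exact hne (by simpa using hij')
    rw [Nat.cast_mul,
      (ZMod.natCast_eq_zero_iff _ _).2 (hp.dvd_choose_pow hi (show i ≠ p ^ n by omega)), zero_mul]
  · intro h
    simp at h

theorem cast_choose_pow_pred {p n t : ℕ} (hp : p.Prime) (ht : t < 2 * p ^ n)
    (hne : t ≠ p ^ n - 1) :
    ((t.choose (p ^ n - 1) : ℕ) : ZMod p) = if t = 2 * p ^ n - 1 then 1 else 0 := by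
  have hpos : 0 < p ^ n := pow_pos hp.pos n
  rcases lt_or_ge t (p ^ n) with h | h
  · rw [Nat.choose_eq_zero_of_lt (show t < p ^ n - 1 by omega), if_neg (by omega), Nat.cast_zero]
  · obtain ⟨y, rfl⟩ := Nat.exists_eq_add_of_le h
    rw [cast_choose_add_pow_pred hp (by omega)]
    exact if_congr (by omega) rfl rfl

/-- A case of the Frankl–Wilson theorem with a prime power modulus: the sets have size `-1` modulo
`k`, and sizes of pairwise intersections are different from `-1` modulo `k`, since among the numbers
below `2 * k - 1` only `k - 1` is `-1` modulo `k`. -/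
theorem card_le_choose_of_card_inter_ne {α : Type*} [DecidableEq α] {k : ℕ} (hk : IsPrimePow k)
    (s : Finset α) (F : Finset (Finset α)) (hF : F ⊆ s.powersetCard (2 * k - 1))
    (hinter : ∀ A ∈ F, ∀ B ∈ F, A ≠ B → #(A ∩ B) ≠ k - 1) :
    #F ≤ (#s).choose (k - 1) := by
  obtain ⟨p, n, hp, -, rfl⟩ := (isPrimePow_nat_iff _).1 hk
  have : Fact p.Prime := ⟨hp⟩
  set k := p ^ n
  have hpos : 0 < k := pow_pos hp.pos n
  -- `N` is the inclusion matrix, whose rows turn out to be orthonormal for the dot product.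
  let N : F → s.powersetCard (k - 1) → ZMod p := fun A I => if I.1 ⊆ A.1 then 1 else 0
  have hdot : ∀ A B : F, N A ⬝ᵥ N B = if A = B then 1 else 0 := by
    intro A B
    have hA := mem_powersetCard.1 (hF A.2)
    have hB := mem_powersetCard.1 (hF B.2)
    have hsub : (s.powersetCard (k - 1)).filter (fun I => I ⊆ A.1 ∧ I ⊆ B.1) =
        (A.1 ∩ B.1).powersetCard (k - 1) := by
      ext I
      simp only [mem_filter, mem_powersetCard, subset_inter_iff]
      exact ⟨fun h => ⟨h.2, h.1.2⟩, fun h => ⟨⟨h.1.1.trans hA.1, h.2⟩, h.1⟩⟩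
    have hsum : N A ⬝ᵥ N B = (((#(A.1 ∩ B.1)).choose (k - 1) : ℕ) : ZMod p) := by
      rw [← card_powersetCard, ← hsub, ← Finset.sum_boole]
      simp only [dotProduct, N, ite_zero_mul_ite_zero, mul_one]
      exact Finset.sum_coe_sort (s.powersetCard (k - 1))
        (fun I => if I ⊆ A.1 ∧ I ⊆ B.1 then (1 : ZMod p) else 0)
    have hle : #(A.1 ∩ B.1) ≤ 2 * k - 1 := hA.2 ▸ card_le_card inter_subset_left
    have hne : #(A.1 ∩ B.1) ≠ k - 1 := by
      rcases eq_or_ne A B with h | h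
      · rw [h, inter_self, hB.2]
        omega
      · exact hinter _ A.2 _ B.2 (fun h' => h (Subtype.ext h'))
    rw [hsum, cast_choose_pow_pred hp (by omega) hne]
    refine if_congr ⟨fun h => ?_, fun h => ?_⟩ rfl rfl
    · have h1 := eq_of_subset_of_card_le (inter_subset_left : A.1 ∩ B.1 ⊆ A.1) (by omega)
      have h2 := eq_of_subset_of_card_le (inter_subset_right : A.1 ∩ B.1 ⊆ B.1) (by omega)
      exact Subtype.ext (h1.symm.trans h2)
    · rw [h, inter_self, hB.2]
  have hli : LinearIndependent (ZMod p) N :=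
    LinearIndependent.of_pairwise_dual_eq_zero_one N
      (fun A => dotProductBilin (ZMod p) (ZMod p) (N A))
      (fun A B h => (hdot A B).trans (if_neg h)) (fun A => (hdot A A).trans (if_pos rfl))
  simpa using hli.fintype_card_le_finrank

/-! ### Cuts -/

variable {m : ℕ}

theorem mk_mem_cut {A : Finset (Fin m)} {a b : Fin m} (h : ¬ s(a, b).IsDiag) :
    (⟨s(a, b), h⟩ : Pair m) ∈ cut A ↔ (a ∈ A ∧ b ∉ A ∨ b ∈ A ∧ a ∉ A) := by
  constructor
  · rintro ⟨x, hx, y, hy, hxy⟩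
    rcases Sym2.eq_iff.1 hxy with ⟨rfl, rfl⟩ | ⟨rfl, rfl⟩
    · exact Or.inl ⟨hx, hy⟩
    · exact Or.inr ⟨hx, hy⟩
  · rintro (⟨ha, hb⟩ | ⟨hb, ha⟩)
    · exact ⟨a, ha, b, hb, rfl⟩
    · exact ⟨b, hb, a, ha, Sym2.eq_swap⟩

theorem cut_compl (A : Finset (Fin m)) : cut Aᶜ = cut A := by
  ext ⟨e, he⟩
  induction e with | _ a b
  rw [mk_mem_cut, mk_mem_cut]
  simp only [mem_compl]
  tauto

theorem cut_symmDiff (A B : Finset (Fin m)) : cut (symmDiff A B) = symmDiff (cut A) (cut B) := by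
  ext ⟨e, he⟩
  induction e with | _ a b
  rw [Set.mem_symmDiff, mk_mem_cut, mk_mem_cut, mk_mem_cut]
  simp only [mem_symmDiff]
  tauto

/-- A cut determines its bipartition, so it determines the side that contains `v`. -/
theorem cut_injOn (v : Fin m) : Set.InjOn cut {A : Finset (Fin m) | v ∈ A} := by
  intro A hA B hB h
  have hA : v ∈ A := hA
  have hB : v ∈ B := hB
  ext x
  rcases eq_or_ne v x with rfl | hx
  · simp [hA, hB]
  · have := Set.ext_iff.1 h ⟨s(v, x), by simpa using hx⟩
    rw [mk_mem_cut, mk_mem_cut] at this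
    tauto

theorem ncard_cut (A : Finset (Fin m)) : (cut A).ncard = #A * (m - #A) := by
  have hne : ∀ x ∈ A ×ˢ Aᶜ, ¬ s(x.1, x.2).IsDiag := by
    intro x hx h
    rw [mem_product, mem_compl] at hx
    rw [Sym2.mk_isDiag_iff] at h
    exact hx.2 (h ▸ hx.1)
  have himg : Subtype.val '' cut A = (fun x : Fin m × Fin m => s(x.1, x.2)) '' ↑(A ×ˢ Aᶜ) := by
    ext e
    constructor
    · rintro ⟨e, ⟨a, ha, b, hb, h⟩, rfl⟩
      exact ⟨(a, b), by simp [ha, hb], h.symm⟩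
    · rintro ⟨x, hx, rfl⟩
      have hx' := hx
      rw [mem_coe, mem_product, mem_compl] at hx'
      exact ⟨⟨_, hne x hx⟩, ⟨x.1, hx'.1, x.2, hx'.2, rfl⟩, rfl⟩
  rw [← Set.ncard_image_of_injective _ Subtype.val_injective, himg, Set.InjOn.ncard_image,
    Set.ncard_coe_finset, card_product, card_compl, Fintype.card_fin]
  rintro ⟨a, b⟩ hx ⟨c, d⟩ hy h
  simp only [mem_coe, mem_product, mem_compl] at hx hy
  rcases Sym2.eq_iff.1 h with ⟨rfl, rfl⟩ | ⟨rfl, rfl⟩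
  · rfl
  · exact absurd hx.1 hy.2

/-! ### Zero-one vectors -/

theorem zeroOneVector_injective {ι : Type} :
    Function.Injective (zeroOneVector : Set ι → EuclideanSpace ℝ ι) :=
  fun _ _ h => Set.indicator_one_inj ℝ (WithLp.toLp_injective 2 h)

theorem zeroOneVector_apply {ι : Type} (X : Set ι) [DecidablePred (· ∈ X)] (i : ι) :
    zeroOneVector X i = if i ∈ X then 1 else 0 :=
  Set.indicator_apply X (fun _ => (1 : ℝ)) i

theorem dist_sq_zeroOneVector {ι : Type} [Fintype ι] (X Y : Set ι) :
    dist (zeroOneVector X) (zeroOneVector Y) ^ 2 = ((symmDiff X Y).ncard : ℝ) := by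
  classical
  rw [EuclideanSpace.dist_sq_eq, Set.ncard_eq_toFinset_card', ← Set.filter_mem_univ_eq_toFinset,
    natCast_card_filter]
  refine Finset.sum_congr rfl fun i _ => ?_
  rw [zeroOneVector_apply, zeroOneVector_apply, Set.mem_symmDiff]
  by_cases hX : i ∈ X <;> by_cases hY : i ∈ Y <;> simp [hX, hY]

/-- The inner product with the all-ones vector counts the elements of a set. -/
theorem inner_zeroOneVector_univ {ι : Type} [Fintype ι] (X : Set ι) :
    inner ℝ (zeroOneVector Set.univ) (zeroOneVector X) = (X.ncard : ℝ) := by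
  classical
  rw [Set.ncard_eq_toFinset_card', ← Set.filter_mem_univ_eq_toFinset, natCast_card_filter,
    PiLp.inner_apply]
  refine Finset.sum_congr rfl fun i _ => ?_
  rw [zeroOneVector_apply, zeroOneVector_apply]
  simp

/-! ### Euclidean geometry -/

theorem exists_linearIsometry_of_finrank_le {V : Type*} [NormedAddCommGroup V]
    [InnerProductSpace ℝ V] [FiniteDimensional ℝ V] {n : ℕ} (h : finrank ℝ V ≤ n) :
    Nonempty (V →ₗᵢ[ℝ] EuclideanSpace ℝ (Fin n)) := by
  let b := stdOrthonormalBasis ℝ V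
  let c : Fin (finrank ℝ V) → EuclideanSpace ℝ (Fin n) :=
    fun i => EuclideanSpace.basisFun (Fin n) ℝ (Fin.castLE h i)
  have hc : Orthonormal ℝ c :=
    (EuclideanSpace.basisFun (Fin n) ℝ).orthonormal.comp _ (Fin.castLE_injective h)
  refine ⟨(b.toBasis.constr ℝ c).isometryOfOrthonormal (v := b.toBasis) (by simp) ?_⟩
  convert hc using 1
  ext1 i
  simp

theorem exists_isometry_of_subset_affineSubspace {V : Type*} [NormedAddCommGroup V]
    [InnerProductSpace ℝ V] [FiniteDimensional ℝ V] {n : ℕ} {X : Set V} (E : AffineSubspace ℝ V)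
    (hX : X ⊆ E) (h : finrank ℝ E.direction ≤ n) :
    ∃ f : X → EuclideanSpace ℝ (Fin n), Isometry f := by
  rcases X.eq_empty_or_nonempty with rfl | ⟨x₀, hx₀⟩
  · exact ⟨fun _ => 0, fun x => x.2.elim⟩
  obtain ⟨L⟩ := exists_linearIsometry_of_finrank_le h
  refine ⟨fun x => L ⟨x.1 -ᵥ x₀, E.vsub_mem_direction (hX x.2) (hX hx₀)⟩,
    Isometry.of_dist_eq fun x y => ?_⟩
  rw [L.isometry.dist_eq, Subtype.dist_eq, Subtype.dist_eq]
  simp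

/-! ### The point set -/

variable {k : ℕ}

theorem dist_sq_zeroOneVector_cut (A B : Finset (Fin m)) :
    dist (zeroOneVector (cut A)) (zeroOneVector (cut B)) ^ 2 =
      #(symmDiff A B) * (m - #(symmDiff A B) : ℝ) := by
  have h : #(symmDiff A B) ≤ m := by simpa using card_le_univ (symmDiff A B)
  rw [dist_sq_zeroOneVector, ← cut_symmDiff, ncard_cut, Nat.cast_mul, Nat.cast_sub h]

/-- Passing to complements, every point of `pointSet k` comes from a set containing `v`; by
`injOn_zeroOneVector_cut`, this set is unique. -/
theorem pointSet_eq_image (v : Fin (4 * k)) : pointSet k =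
    (fun A => zeroOneVector (cut A)) ''
      ↑((univ.powersetCard (2 * k)).filter fun A : Finset (Fin (4 * k)) => v ∈ A) := by
  ext x
  constructor
  · rintro ⟨A, hA, rfl⟩
    by_cases hv : v ∈ A
    · exact ⟨A, by simp [hA, hv], rfl⟩
    · refine ⟨Aᶜ, ?_, by simp only [cut_compl]⟩
      simp only [coe_filter, mem_powersetCard_univ, card_compl, Fintype.card_fin, mem_compl,
        Set.mem_ofPred_eq]
      exact ⟨by omega, hv⟩
  · rintro ⟨A, hA, rfl⟩
    rw [mem_coe, mem_filter, mem_powersetCard_univ] at hA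
    exact ⟨A, hA.1, rfl⟩

theorem finite_pointSet (k : ℕ) : (pointSet k).Finite := by
  refine (Set.finite_range fun A : Finset (Fin (4 * k)) => zeroOneVector (cut A)).subset ?_
  rintro x ⟨A, -, rfl⟩
  exact ⟨A, rfl⟩

theorem injOn_zeroOneVector_cut (v : Fin m) :
    Set.InjOn (fun A => zeroOneVector (cut A)) {A : Finset (Fin m) | v ∈ A} :=
  zeroOneVector_injective.comp_injOn (cut_injOn v)

theorem two_mul_ncard_pointSet (hk : 0 < k) : 2 * (pointSet k).ncard = (4 * k).choose (2 * k) := by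
  let v : Fin (4 * k) := ⟨0, by omega⟩
  rw [pointSet_eq_image v, Set.InjOn.ncard_image, Set.ncard_coe_finset]
  · -- Complementation exchanges the `2k`-sets with `v` and those without.
    have h : #((univ.powersetCard (2 * k)).filter fun A : Finset (Fin (4 * k)) => v ∈ A) =
        #((univ.powersetCard (2 * k)).filter fun A : Finset (Fin (4 * k)) => v ∉ A) := by
      refine card_bij' (fun A _ => Aᶜ) (fun A _ => Aᶜ) ?_ ?_ (fun A _ => compl_compl A)
        (fun A _ => compl_compl A)
      all_goals
        intro A hA
        simp only [mem_filter, mem_powersetCard_univ, card_compl, Fintype.card_fin, mem_compl,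
          not_not] at hA ⊢
        exact ⟨by omega, hA.2⟩
    rw [two_mul]
    nth_rw 2 [h]
    rw [card_filter_add_card_filter_not, card_powersetCard, card_univ, Fintype.card_fin]
  · exact (injOn_zeroOneVector_cut v).mono fun A hA => (mem_filter.1 hA).2

/-- Equality holds for `k > 0`, but only the upper bound is needed: a subset of smaller diameter
contains no two points at distance `2 * k`. -/
theorem diam_pointSet_le (k : ℕ) : Metric.diam (pointSet k) ≤ 2 * k := by
  refine Metric.diam_le_of_forall_dist_le (by positivity) ?_
  rintro _ ⟨A, -, rfl⟩ _ ⟨B, -, rfl⟩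
  refine abs_le_of_sq_le_sq' ?_ (by positivity) |>.2
  rw [dist_sq_zeroOneVector_cut]
  push_cast
  nlinarith [sq_nonneg ((#(symmDiff A B) : ℝ) - 2 * k)]

/-- A subset of smaller diameter contains no two points whose sets meet in `k` elements, so the
modular intersection theorem applies to the sets containing a fixed element `v`, with `v` removed. -/
theorem ncard_le_of_diam_lt (hk : IsPrimePow k) {T : Set (EuclideanSpace ℝ (Pair (4 * k)))}
    (hT : T ⊆ pointSet k) (hdiam : Metric.diam T < Metric.diam (pointSet k)) :
    T.ncard ≤ (4 * k - 1).choose (k - 1) := by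
  classical
  have hpos : 0 < k := hk.pos
  let v : Fin (4 * k) := ⟨0, by omega⟩
  let F : Finset (Finset (Fin (4 * k))) := univ.filter fun A =>
    (#A = 2 * k ∧ v ∈ A) ∧ zeroOneVector (cut A) ∈ T
  have hF : ∀ {A}, A ∈ F ↔ (#A = 2 * k ∧ v ∈ A) ∧ zeroOneVector (cut A) ∈ T := by simp [F]
  have hTF : T ⊆ (fun A => zeroOneVector (cut A)) '' ↑F := by
    intro x hx
    have hxK := hT hx
    rw [pointSet_eq_image v] at hxK
    obtain ⟨A, hA, rfl⟩ := hxK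
    rw [mem_coe, mem_filter, mem_powersetCard_univ] at hA
    exact ⟨A, hF.2 ⟨hA, hx⟩, rfl⟩
  have hTfin : T.Finite := (finite_pointSet k).subset hT
  -- Sets meeting in `k` elements would give points at the maximal distance `2k`.
  have hinter : ∀ A ∈ F, ∀ B ∈ F, #(A ∩ B) ≠ k := by
    intro A hA B hB hAB
    have hcard : #(symmDiff A B) = 2 * k := by
      have h1 := card_sdiff_add_card_inter A B
      have h2 := card_sdiff_add_card_inter B A
      rw [inter_comm B A] at h2
      have h3 : #(symmDiff A B) = #(A \ B) + #(B \ A) :=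
        card_union_of_disjoint disjoint_sdiff_sdiff
      have := (hF.1 hA).1.1
      have := (hF.1 hB).1.1
      omega
    have hlt : dist (zeroOneVector (cut A)) (zeroOneVector (cut B)) < 2 * k :=
      (Metric.dist_le_diam_of_mem hTfin.isBounded (hF.1 hA).2 (hF.1 hB).2).trans_lt
        (hdiam.trans_le (diam_pointSet_le k))
    have hsq := dist_sq_zeroOneVector_cut A B
    rw [hcard] at hsq
    push_cast at hsq
    nlinarith [dist_nonneg (x := zeroOneVector (cut A)) (y := zeroOneVector (cut B))]
  calc T.ncard ≤ #F := by
        refine (Set.ncard_le_ncard hTF (F.finite_toSet.image _)).trans ?_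
        exact (Set.ncard_image_le F.finite_toSet).trans_eq (Set.ncard_coe_finset F)
    _ = #(F.image fun A => A.erase v) := by
        refine (card_image_of_injOn fun A hA B hB h => ?_).symm
        rw [← insert_erase (hF.1 hA).1.2, ← insert_erase (hF.1 hB).1.2]
        exact congrArg (insert v) h
    _ ≤ (#(univ.erase v)).choose (k - 1) := by
        refine card_le_choose_of_card_inter_ne hk _ _ ?_ ?_
        · intro A' hA'
          obtain ⟨A, hA, rfl⟩ := mem_image.1 hA'
          rw [mem_powersetCard, card_erase_of_mem (hF.1 hA).1.2, (hF.1 hA).1.1]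
          exact ⟨erase_subset_erase _ (subset_univ A), rfl⟩
        · intro A' hA' B' hB' _
          obtain ⟨A, hA, rfl⟩ := mem_image.1 hA'
          obtain ⟨B, hB, rfl⟩ := mem_image.1 hB'
          have hv : v ∈ A ∩ B := mem_inter.2 ⟨(hF.1 hA).1.2, (hF.1 hB).1.2⟩
          have := card_pos.2 ⟨v, hv⟩
          have := hinter A hA B hB
          rw [erase_inter, inter_erase, erase_idem, card_erase_of_mem hv]
          omega
    _ = (4 * k - 1).choose (k - 1) := by
        rw [card_erase_of_mem (mem_univ v), card_univ, Fintype.card_fin]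

theorem ncard_pointSet_div (hk : 0 < k) :
    ((pointSet k).ncard : ℝ) / ((4 * k - 1).choose (k - 1) : ℝ) = coverBound k := by
  rw [coverBound, ← two_mul_ncard_pointSet hk, Nat.cast_mul, Nat.cast_two,
    mul_div_mul_left _ _ two_ne_zero]

theorem coverBound_le_ncard (hk : IsPrimePow k)
    {P : Set (Set (EuclideanSpace ℝ (Pair (4 * k))))}
    (hP : ∀ T ∈ P, T ⊆ pointSet k ∧ Metric.diam T < Metric.diam (pointSet k))
    (hcover : ⋃₀ P = pointSet k) : coverBound k ≤ P.ncard := by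
  -- `P` is finite, so that `P.ncard` is its true cardinality.
  have hPfin : P.Finite := (finite_pointSet k).finite_subsets.subset fun T hT => (hP T hT).1
  have hle : (pointSet k).ncard ≤ P.ncard * (4 * k - 1).choose (k - 1) := by
    rw [← hcover, Set.sUnion_eq_biUnion, ← hPfin.coe_toFinset, Set.ncard_coe_finset]
    refine (hPfin.toFinset.set_ncard_biUnion_le _).trans (sum_le_card_nsmul _ _ _ fun T hT => ?_)
    have hT := hP T (hPfin.mem_toFinset.1 hT)
    exact ncard_le_of_diam_lt hk hT.1 hT.2
  have hpos : 0 < (4 * k - 1).choose (k - 1) := Nat.choose_pos (by omega)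
  rw [← ncard_pointSet_div hk.pos, div_le_iff₀ (by exact_mod_cast hpos)]
  exact_mod_cast hle

/-- The affine subspace is the hyperplane on which the coordinates sum to `4 * k ^ 2`. -/
theorem exists_affineSubspace_pointSet (hk : 0 < k) :
    ∃ E : AffineSubspace ℝ (EuclideanSpace ℝ (Pair (4 * k))),
      pointSet k ⊆ E ∧ finrank ℝ E.direction = dimension k := by
  have hcard : Fintype.card (Pair (4 * k)) = (4 * k).choose 2 := by
    rw [Sym2.card_subtype_not_diag, Fintype.card_fin]
  have hpos : 0 < (4 * k).choose 2 := Nat.choose_pos (by omega)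
  let u : EuclideanSpace ℝ (Pair (4 * k)) := zeroOneVector Set.univ
  have hu : u ≠ 0 := by
    intro h
    have hinner : inner ℝ u u = _ := inner_zeroOneVector_univ Set.univ
    rw [h, inner_zero_left, Set.ncard_univ, Nat.card_eq_fintype_card, hcard] at hinner
    exact hpos.ne (by exact_mod_cast hinner)
  have hinner : ∀ x ∈ pointSet k, inner ℝ u x = ((2 * k * (2 * k) : ℕ) : ℝ) := by
    rintro _ ⟨A, hA, rfl⟩
    rw [inner_zeroOneVector_univ, ncard_cut, hA]
    congr 2
    omega
  have hrank : finrank ℝ (Submodule.span ℝ {u})ᗮ = dimension k := by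
    have : Fact (finrank ℝ (EuclideanSpace ℝ (Pair (4 * k))) = dimension k + 1) :=
      ⟨by rw [finrank_euclideanSpace, hcard, dimension]; omega⟩
    exact Submodule.finrank_orthogonal_span_singleton hu
  rcases (pointSet k).eq_empty_or_nonempty with h | ⟨x₀, hx₀⟩
  · exact ⟨AffineSubspace.mk' 0 (Submodule.span ℝ {u})ᗮ, by simp [h],
      by rw [AffineSubspace.direction_mk', hrank]⟩
  refine ⟨AffineSubspace.mk' x₀ (Submodule.span ℝ {u})ᗮ, fun x hx => ?_,
    by rw [AffineSubspace.direction_mk', hrank]⟩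
  rw [SetLike.mem_coe, AffineSubspace.mem_mk', Submodule.mem_orthogonal_singleton_iff_inner_right,
    vsub_eq_sub, inner_sub_right, hinner x hx, hinner x₀ hx₀, sub_self]

/-- A cover of the copy by `n + 1` sets of smaller diameter pulls back to a cover of `pointSet k`,
and so `n + 1` is at least `coverBound k`. -/
theorem isBorsukCounterexample_range (hk : IsPrimePow k) {n : ℕ}
    (hn : (n : ℝ) < coverBound k - 1) {f : pointSet k → EuclideanSpace ℝ (Fin n)}
    (hf : Isometry f) : IsBorsukCounterexample n (Set.range f) := by
  have hfin : Finite (pointSet k) := finite_pointSet k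
  refine ⟨(Set.finite_range f).isBounded, ?_, ?_⟩
  · have hlt : 1 < (pointSet k).ncard := by
      have hpos : 0 < (4 * k - 1).choose (k - 1) := Nat.choose_pos (by omega)
      have hdiv := ncard_pointSet_div hk.pos
      have h1 : (1 : ℝ) < coverBound k := by linarith [n.cast_nonneg (α := ℝ)]
      rw [← hdiv, lt_div_iff₀ (by exact_mod_cast hpos), one_mul] at h1
      have : (4 * k - 1).choose (k - 1) < (pointSet k).ncard := by exact_mod_cast h1
      omega
    have : Nontrivial (pointSet k) :=
      (Set.one_lt_ncard_iff_nontrivial.1 hlt).coe_sort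
    exact Set.image_univ ▸ Set.nontrivial_univ.image hf.injective
  · rintro ⟨T, hT, hcover⟩
    let g : Fin (n + 1) → Set (EuclideanSpace ℝ (Pair (4 * k))) :=
      fun i => Subtype.val '' (f ⁻¹' T i)
    have hdiam : Metric.diam (Set.range f) = Metric.diam (pointSet k) := by
      rw [← Set.image_univ, hf.diam_image, ← isometry_subtype_coe.diam_image, Set.image_univ,
        Subtype.range_coe]
    have hg : coverBound k ≤ ((Set.range g).ncard : ℝ) := by
      refine coverBound_le_ncard hk ?_ ?_
      · rintro _ ⟨i, rfl⟩
        refine ⟨Subtype.coe_image_subset _ _, ?_⟩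
        rw [isometry_subtype_coe.diam_image, ← hf.diam_image,
          Set.image_preimage_eq_of_subset (hT i).1, ← hdiam]
        exact (hT i).2
      · rw [Set.sUnion_range, ← Set.image_iUnion, ← Set.preimage_iUnion, hcover,
          Set.preimage_range, Set.image_univ, Subtype.range_coe]
    have hle : (Set.range g).ncard ≤ n + 1 := by
      rw [← Set.image_univ]
      exact (Set.ncard_image_le Set.finite_univ).trans_eq (by simp [Set.ncard_univ])
    have : ((Set.range g).ncard : ℝ) ≤ n + 1 := by exact_mod_cast hle
    linarith

end KahnKalai

theorem mainTheorem1 (k : ℕ) (hk : IsPrimePow k) :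
    -- `K` lies in a `d`-dimensional Euclidean space
    (∃ E : AffineSubspace ℝ (EuclideanSpace ℝ (KahnKalai.Pair (4 * k))),
      KahnKalai.pointSet k ⊆ (E : Set (EuclideanSpace ℝ (KahnKalai.Pair (4 * k)))) ∧
      Module.finrank ℝ E.direction = KahnKalai.dimension k) ∧
    -- subsets of smaller diameter have at most `C(4k-1, k-1)` points
    (∀ T : Set (EuclideanSpace ℝ (KahnKalai.Pair (4 * k))),
      T ⊆ KahnKalai.pointSet k → Metric.diam T < Metric.diam (KahnKalai.pointSet k) →
      T.ncard ≤ (4 * k - 1).choose (k - 1)) ∧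
    -- `|K| / C(4k-1, k-1) = q`
    ((KahnKalai.pointSet k).ncard : ℝ) / ((4 * k - 1).choose (k - 1) : ℝ) =
      KahnKalai.coverBound k ∧
    -- a cover of `K` by subsets of smaller diameter has at least `q` members
    (∀ P : Set (Set (EuclideanSpace ℝ (KahnKalai.Pair (4 * k)))),
      (∀ T ∈ P, T ⊆ KahnKalai.pointSet k ∧
        Metric.diam T < Metric.diam (KahnKalai.pointSet k)) →
      ⋃₀ P = KahnKalai.pointSet k →
      KahnKalai.coverBound k ≤ (P.ncard : ℝ)) ∧
    -- `q` is twice the earlier bound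
    KahnKalai.coverBound k = 2 * KahnKalai.kahnKalaiBound k ∧
    -- if `q > d + 1`, then `K` is a counterexample in all dimensions `n` with `d ≤ n < q - 1`
    ((KahnKalai.dimension k : ℝ) + 1 < KahnKalai.coverBound k →
      ∀ n : ℕ, KahnKalai.dimension k ≤ n → (n : ℝ) < KahnKalai.coverBound k - 1 →
        ∃ f : KahnKalai.pointSet k → EuclideanSpace ℝ (Fin n),
          Isometry f ∧ KahnKalai.IsBorsukCounterexample n (Set.range f)) := by
  obtain ⟨E, hKE, hE⟩ := KahnKalai.exists_affineSubspace_pointSet hk.pos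
  refine ⟨⟨E, hKE, hE⟩, fun T hT hdiam => KahnKalai.ncard_le_of_diam_lt hk hT hdiam,
    KahnKalai.ncard_pointSet_div hk.pos,
    fun P hP hcover => KahnKalai.coverBound_le_ncard hk hP hcover, ?_, fun _ n hdn hn => ?_⟩
  · rw [KahnKalai.coverBound, KahnKalai.kahnKalaiBound]
    ring
  · obtain ⟨f, hf⟩ := KahnKalai.exists_isometry_of_subset_affineSubspace E hKE (hE.trans_le hdn)
    exact ⟨f, hf, KahnKalai.isBorsukCounterexample_range hk hn hf⟩
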